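/- **Theorem (Formulation for Rare Set).** Let $1\le p\le\infty$, let $E\subseteq\mathbb{R}^d$ be a Borel set with the distance of the $\ell_p$-norm $\|\cdot\|=\|\cdot\|_p$, and let $A\subseteq E$ be a Borel set. A point configuration on $E$ is a locally finite counting measure $N=\sum_n \mathbf{1}_{X^{(n)}}$ with finitely or countably many, possibly repeated, points $X^{(n)}\in E$; the law of a point process on $E$ is a probability measure on the space of point configurations with the $\sigma$-algebra generated by the maps $N\mapsto N(B)$, $B$ Borel. For configurations $N=\sum_i\mathbf{1}_{x_i}$ and $N'=\sum_i\mathbf{1}_{y_i}$ with the same number of points, let $$\widetilde c(N,N')=\inf_\sigma\sum_{i}\|x_i-y_{\sigma(i)}\|,$$ the infimum being over all bijections between the points of $N$ and those of $N'$, and let $\widetilde c(N,N')=\infty$ if $N(E)\neq N'(E)$. Let $\widetilde c_{\rm fin}(N,N')=\widetilde c(N,N')$ if $N(E)=N'(E)<\infty$, and $\widetilde c_{\rm fin}(N,N')=\infty$ otherwise. For a cost $k\in\{\widetilde c,\widetilde c_{\rm fin}\}$ put $W_k(P,P_0)=\inf_\gamma \mathbb{E}_{(N,N')\sim\gamma}\,k(N,N')$,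 the infimum over all couplings $\gamma$ of $P$ and $P_0$. Let $P_0$ be the law of a point process on $E$ (for instance of a Poisson point process), and let $\delta\ge 0$. If $\delta=0$, suppose in addition that $A$ is closed in $E$ and that $P_0$-almost every $N$ has only finitely many points in $\{x\in E:\inf_{y\in A}\|y-x\|<r\}$ for some $r>0$, which may depend on $N$ (automatic if $N(E)<\infty$). Then $$\sup_{P:\,W_{k}(P,P_0)\le\delta}P\big(N(A)\ge 1\big)=\inf_{\lambda\ge0}\Big\{\lambda\delta+\mathbb{E}_{P_0}\Big(1-\lambda\inf_n\inf_{y\in A}\|y-X^{(n)}\|\Big)^+\Big\}$$ holds for $k=\widetilde c$, and it holds for $k=\widetilde c_{\rm fin}$ whenever $N(E)<\infty$ for $P_0$-almost every $N$. Here $P$ ranges over all laws of point processes on $E$, an infimum over the empty set is $+\infty$, and $0\cdot\infty=0$. -/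

import Mathlib

open MeasureTheory
open scoped NNReal ENNReal

/-- Point configurations on `S`: locally finite counting measures, that is, locally finite
measures of the form `∑ i, δ_{x i}` with finitely or countably many, possibly repeated, points.
The `σ`-algebra is the usual one, generated by the evaluations `N ↦ N B`, `B` measurable
(inherited from Mathlib's `σ`-algebra on `Measure S`). -/
abbrev PointConfig (S : Type*) [TopologicalSpace S] [MeasurableSpace S] : Type _ :=
  {N : Measure S // IsLocallyFiniteMeasure N ∧
    ∃ (I : Set ℕ) (x : I → S), N = Measure.sum (fun i => Measure.dirac (x i))}

/-- The transport cost between two finite configurations for the point cost `dist`: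
the infimum over all permutations `σ` of `∑ i, dist (x i) (y (σ i))`. It is `∞` (the infimum of
the empty family) unless `N` and `N'` have the same, finite, total number of points. -/
noncomputable def finiteCost {S : Type*} [MetricSpace S] [MeasurableSpace S]
    (N N' : PointConfig S) : ℝ≥0∞ :=
  ⨅ (n : ℕ) (x : Fin n → S) (y : Fin n → S)
    (_ : N.1 = Measure.sum (fun i => Measure.dirac (x i)))
    (_ : N'.1 = Measure.sum (fun i => Measure.dirac (y i)))
    (σ : Equiv.Perm (Fin n)), ∑ i, edist (x i) (y (σ i))

/-- The same transport cost, with infinite configurations matched as well: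
the infimum over all bijections between the points of `N` and those of `N'` of the total distance
between matched points. It is `∞` if the total numbers of points differ. -/
noncomputable def matchingCost {S : Type*} [MetricSpace S] [MeasurableSpace S]
    (N N' : PointConfig S) : ℝ≥0∞ :=
  ⨅ (I : Set ℕ) (x : I → S) (y : I → S)
    (_ : N.1 = Measure.sum (fun i => Measure.dirac (x i)))
    (_ : N'.1 = Measure.sum (fun i => Measure.dirac (y i)))
    (σ : Equiv.Perm I), ∑' i, edist (x i) (y (σ i))

/-- The Wasserstein distance of order one for the cost `c`: the infimum of the expected cost over
all couplings. -/
noncomputable def wassersteinCost {X : Type*} [MeasurableSpace X] (c : X → X → ℝ≥0∞)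
    (P Q : Measure X) : ℝ≥0∞ :=
  ⨅ (γ : Measure (X × X)) (_ : γ.map Prod.fst = P) (_ : γ.map Prod.snd = Q),
    ∫⁻ z, c z.1 z.2 ∂γ

/-- The worst-case probability of at least one point in `A`, over all laws `P` of point processes
within distance `δ` of `P₀`. -/
noncomputable def worstCaseHitProb {S : Type*} [MetricSpace S] [MeasurableSpace S]
    (c : PointConfig S → PointConfig S → ℝ≥0∞) (P₀ : Measure (PointConfig S)) (δ : ℝ≥0)
    (A : Set S) : ℝ≥0∞ :=
  ⨆ (P : Measure (PointConfig S)) (_ : IsProbabilityMeasure P)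
    (_ : wassersteinCost c P P₀ ≤ δ), P {N | 1 ≤ N.1 A}

/-- `inf_n inf_{y ∈ A} dist (y, X n)`, where the `X n` are the points of the configuration `N`;
it is `∞` if `N` has no points or `A` is empty. -/
noncomputable def distToSet {S : Type*} [MetricSpace S] [MeasurableSpace S]
    (N : PointConfig S) (A : Set S) : ℝ≥0∞ :=
  ⨅ (x : S) (_ : 1 ≤ N.1 {x}) (y : S) (_ : y ∈ A), edist y x

/-- `inf_{l ≥ 0} {l δ + E_{P₀} (1 - l inf_n dist (X n, A))⁺}`; subtraction in `ℝ≥0∞` is the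
positive part of the difference. -/
noncomputable def rareSetDual {S : Type*} [MetricSpace S] [MeasurableSpace S]
    (P₀ : Measure (PointConfig S)) (δ : ℝ≥0) (A : Set S) : ℝ≥0∞ :=
  ⨅ l : ℝ≥0, ((l : ℝ≥0∞) * δ + ∫⁻ N, (1 - (l : ℝ≥0∞) * distToSet N A) ∂P₀)

/-! ### Point configurations: evaluations, costs, moving one point -/

section Configurations

variable {S : Type*} [MetricSpace S] [MeasurableSpace S]

/-! Write `D N` for `distToSet N A`. If `N` hits `A`, every matching of `N` with `N'` moves some
point of `N'` into `A`, so it costs at least `D N'`. Integrating `1_{hit} ≤ l * c + (1 - l * D)⁺`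
over a coupling gives weak duality (`worstCaseHitProb_le_rareSetDual`).

Conversely, moving a single point makes `N` hit `A` at cost at most `D N + ε`
(`exists_measurable_transport`). What remains is a continuous knapsack (`exists_knapsack`): choose a
randomized set of configurations of maximal `P₀`-mass whose integrated weight `D` is at most `δ`.
The greedy choice takes `D < t` and a fraction of `D = t`, and the multiplier `1 / t` certifies
optimality. For `δ > 0`, shrinking this choice slightly pays for `ε`. For `δ = 0` nothing can pay
for it; there the dual is at most `P₀ {D = 0}`, and finiteness near the closed set `A` turns `D = 0`
into a hit. -/

theorem sum_dirac_ne_zero_iff [BorelSpace S] {ι : Type*} [Countable ι] (x : ι → S) {B : Set S}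
    (hB : MeasurableSet B) :
    Measure.sum (fun i => Measure.dirac (x i)) B ≠ 0 ↔ ∃ i, x i ∈ B := by
  rw [Measure.sum_apply _ hB, ne_eq, ENNReal.tsum_eq_zero, not_forall]
  refine exists_congr fun i => ?_
  rw [Measure.dirac_apply' _ hB]
  by_cases h : x i ∈ B <;> simp [h]

theorem one_le_sum_dirac_iff [BorelSpace S] {ι : Type*} [Countable ι] (x : ι → S) {B : Set S}
    (hB : MeasurableSet B) :
    1 ≤ Measure.sum (fun i => Measure.dirac (x i)) B ↔ ∃ i, x i ∈ B := by
  constructor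
  · intro h
    exact (sum_dirac_ne_zero_iff x hB).1 (zero_lt_one.trans_le h).ne'
  · rintro ⟨i, hi⟩
    rw [Measure.sum_apply _ hB]
    refine le_trans ?_ (ENNReal.le_tsum i)
    rw [Measure.dirac_apply' _ hB]
    simp [hi]

namespace PointConfig

theorem one_le_iff_ne_zero [BorelSpace S] (N : PointConfig S) {B : Set S} (hB : MeasurableSet B) :
    1 ≤ N.1 B ↔ N.1 B ≠ 0 := by
  obtain ⟨N, -, I, x, rfl⟩ := N
  exact (one_le_sum_dirac_iff x hB).trans (sum_dirac_ne_zero_iff x hB).symm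

theorem one_le_iff_exists [BorelSpace S] (N : PointConfig S) {B : Set S} (hB : MeasurableSet B) :
    1 ≤ N.1 B ↔ ∃ x ∈ B, 1 ≤ N.1 {x} := by
  refine ⟨fun h => ?_, fun ⟨x, hx, h1⟩ => h1.trans (measure_mono (by simpa using hx))⟩
  obtain ⟨I, x, hx⟩ := N.2.2
  rw [hx] at h ⊢
  obtain ⟨i, hi⟩ := (one_le_sum_dirac_iff x hB).1 h
  exact ⟨x i, hi, (one_le_sum_dirac_iff x (measurableSet_singleton _)).2 ⟨i, rfl⟩⟩

theorem measurable_apply {B : Set S} (hB : MeasurableSet B) :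
    Measurable fun N : PointConfig S => N.1 B :=
  (Measure.measurable_coe hB).comp measurable_subtype_coe

/-- In a set of finite mass there are only finitely many points. -/
theorem exists_sum_dirac_finite_preimage [BorelSpace S] (N : PointConfig S) :
    ∃ (I : Set ℕ) (x : I → S), N.1 = Measure.sum (fun i => Measure.dirac (x i)) ∧
      ∀ V, MeasurableSet V → N.1 V < ∞ → (x ⁻¹' V).Finite := by
  obtain ⟨N, -, I, x, rfl⟩ := N
  refine ⟨I, x, rfl, fun V hV h => ?_⟩
  have h1 : ∑' i, (Set.indicator (x ⁻¹' V) 1 i : ℝ≥0∞) ≠ ∞ := by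
    rw [Measure.sum_apply _ hV] at h
    refine ne_of_eq_of_ne (tsum_congr fun i => ?_) h.ne
    rw [Measure.dirac_apply' _ hV]
    rfl
  have h2 := ENNReal.finite_const_le_of_tsum_ne_top h1 one_ne_zero
  refine h2.subset fun i hi => ?_
  simp [Set.indicator_of_mem hi]

end PointConfig

/-- A strict bound on an infimum has a witness, so it becomes one evaluation of `N` on an open set;
measurability of the distance follows. -/
theorem distToSet_lt_iff [BorelSpace S] (N : PointConfig S) (A : Set S) (r : ℝ≥0∞) :
    distToSet N A < r ↔ 1 ≤ N.1 {x | Metric.infEDist x A < r} := by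
  rw [N.one_le_iff_exists (measurableSet_lt Metric.continuous_infEDist.measurable
    measurable_const)]
  simp only [distToSet, iInf_lt_iff, Set.mem_ofPred_eq, Metric.infEDist, exists_prop]
  constructor
  · rintro ⟨x, hx, y, hy, h⟩
    exact ⟨x, ⟨y, hy, by rwa [edist_comm]⟩, hx⟩
  · rintro ⟨x, ⟨y, hy, h⟩, hx⟩
    exact ⟨x, hx, y, hy, by rwa [edist_comm]⟩

theorem measurable_distToSet [BorelSpace S] (A : Set S) :
    Measurable fun N : PointConfig S => distToSet N A := by
  refine measurable_of_Iio fun r => ?_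
  have : (fun N : PointConfig S => distToSet N A) ⁻¹' Set.Iio r =
      (fun N : PointConfig S => N.1 {x | Metric.infEDist x A < r}) ⁻¹' Set.Ici 1 := by
    ext N
    exact distToSet_lt_iff N A r
  rw [this]
  exact PointConfig.measurable_apply (measurableSet_lt Metric.continuous_infEDist.measurable
    measurable_const) measurableSet_Ici

/-- A point in `A` has a partner in `N'`, and that single term already bounds the sum from below. -/
theorem distToSet_le_matchingCost [BorelSpace S] {A : Set S} (hA : MeasurableSet A)
    {N : PointConfig S} (N' : PointConfig S) (h : 1 ≤ N.1 A) :
    distToSet N' A ≤ matchingCost N N' := by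
  simp only [matchingCost, le_iInf_iff]
  intro I x y hx hy σ
  rw [hx, one_le_sum_dirac_iff x hA] at h
  obtain ⟨i, hi⟩ := h
  have h1 : 1 ≤ N'.1 {y (σ i)} := by
    rw [hy, one_le_sum_dirac_iff y (measurableSet_singleton _)]
    exact ⟨σ i, rfl⟩
  exact (iInf₂_le_of_le (y (σ i)) h1 (iInf₂_le (x i) hi)).trans
    (ENNReal.le_tsum (f := fun i => edist (x i) (y (σ i))) i)

omit [MetricSpace S] in
theorem sum_dirac_comp_equiv {ι ι' : Type*} (e : ι' ≃ ι) (z : ι → S) :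
    Measure.sum (fun i => Measure.dirac (z (e i))) = Measure.sum (fun i => Measure.dirac (z i)) :=
  Measure.sum_comp_equiv e fun i => Measure.dirac (z i)

theorem matchingCost_le_finiteCost (N N' : PointConfig S) :
    matchingCost N N' ≤ finiteCost N N' := by
  simp only [finiteCost, le_iInf_iff]
  intro n x y hx hy σ
  obtain ⟨e⟩ : Nonempty (Set.Iio n ≃ Fin n) := ⟨Fin.equivSubtype.symm⟩
  refine iInf_le_of_le (Set.Iio n) <| iInf_le_of_le (fun i => x (e i)) <|
    iInf_le_of_le (fun i => y (e i)) <|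
    iInf_le_of_le (hx.trans (sum_dirac_comp_equiv e x).symm) <|
    iInf_le_of_le (hy.trans (sum_dirac_comp_equiv e y).symm) <|
    iInf_le_of_le (e.trans (σ.trans e.symm)) ?_
  rw [← tsum_fintype (L := .unconditional _), ← e.tsum_eq]
  simp

/-- Matching the `i`-th point of one configuration with the `i`-th point of another one. -/
theorem matchingCost_le_tsum {N N' : PointConfig S} {I : Set ℕ} {x y : I → S}
    (hx : N.1 = Measure.sum (fun i => Measure.dirac (x i)))
    (hy : N'.1 = Measure.sum (fun i => Measure.dirac (y i))) :
    matchingCost N N' ≤ ∑' i, edist (x i) (y i) :=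
  iInf_le_of_le I <| iInf_le_of_le x <| iInf_le_of_le y <| iInf_le_of_le hx <|
    iInf_le_of_le hy <| iInf_le _ (Equiv.refl I)

theorem finiteCost_le_tsum {N N' : PointConfig S} {I : Set ℕ} [Finite I] {x y : I → S}
    (hx : N.1 = Measure.sum (fun i => Measure.dirac (x i)))
    (hy : N'.1 = Measure.sum (fun i => Measure.dirac (y i))) :
    finiteCost N N' ≤ ∑' i, edist (x i) (y i) := by
  obtain ⟨n, ⟨e⟩⟩ := Finite.exists_equiv_fin I
  refine iInf_le_of_le n <| iInf_le_of_le (fun i => x (e.symm i)) <|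
    iInf_le_of_le (fun i => y (e.symm i)) <|
    iInf_le_of_le (hx.trans (sum_dirac_comp_equiv e.symm x).symm) <|
    iInf_le_of_le (hy.trans (sum_dirac_comp_equiv e.symm y).symm) <|
    iInf_le_of_le (Equiv.refl _) ?_
  rw [← tsum_fintype (L := .unconditional _), ← e.symm.tsum_eq]
  simp

theorem matchingCost_self (N : PointConfig S) : matchingCost N N = 0 := by
  obtain ⟨I, x, hx⟩ := N.2.2
  simpa using matchingCost_le_tsum hx hx

theorem finiteCost_self [BorelSpace S] {N : PointConfig S} (hN : N.1 Set.univ < ∞) :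
    finiteCost N N = 0 := by
  obtain ⟨I, x, hx, hfin⟩ := N.exists_sum_dirac_finite_preimage
  have : Finite I := Set.finite_univ_iff.1 (by simpa using hfin _ MeasurableSet.univ hN)
  simpa using finiteCost_le_tsum hx hx

/-- `N` has a point in `U`, and all its points in `U` are at the same place. -/
def IsolatedIn (U : Set S) (N : PointConfig S) : Prop :=
  ∃ x ∈ U, 1 ≤ N.1 {x} ∧ N.1 (U \ {x}) = 0

/-- Basic open sets separate points, so all points in `U` coincide exactly when no basic `V` splits
the mass of `U`: countably many conditions on evaluations. -/
theorem measurableSet_isolatedIn [BorelSpace S] [SecondCountableTopology S] {U : Set S}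
    (hU : MeasurableSet U) : MeasurableSet {N : PointConfig S | IsolatedIn U N} := by
  set b := TopologicalSpace.countableBasis S
  have hb := TopologicalSpace.isBasis_countableBasis S
  have hbm : ∀ V ∈ b, MeasurableSet V := fun V hV => (hb.isOpen hV).measurableSet
  have hbc : b.Countable := TopologicalSpace.countable_countableBasis S
  have : {N : PointConfig S | IsolatedIn U N} =
      {N | 1 ≤ N.1 U} ∩ ⋂ V ∈ b, ({N | N.1 (U ∩ V) = 0} ∪ {N | N.1 (U \ V) = 0}) := by
    ext N
    simp only [Set.mem_ofPred_eq, Set.mem_inter_iff, Set.mem_iInter, Set.mem_union]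
    constructor
    · rintro ⟨x, hx, h1, h0⟩
      refine ⟨(N.one_le_iff_exists hU).2 ⟨x, hx, h1⟩, fun V hV => ?_⟩
      by_cases hxV : x ∈ V
      · exact .inr (measure_mono_null (t := U \ {x})
          (fun y hy => ⟨hy.1, fun h => hy.2 (h ▸ hxV)⟩) h0)
      · exact .inl (measure_mono_null (t := U \ {x})
          (fun y hy => ⟨hy.1, fun h => hxV (h ▸ hy.2)⟩) h0)
    · rintro ⟨h1, h0⟩
      obtain ⟨x, hx, hx1⟩ := (N.one_le_iff_exists hU).1 h1
      refine ⟨x, hx, hx1, ?_⟩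
      have hsub : U \ {x} ⊆ ⋃ V ∈ {V ∈ b | x ∈ V}, U \ V := by
        rintro y ⟨hyU, hyx⟩
        obtain ⟨V, hV, hxV, hsub⟩ := hb.exists_subset_of_mem_open
          (show x ∈ ({y}ᶜ : Set S) from fun h => hyx h.symm) isOpen_compl_singleton
        exact Set.mem_biUnion (x := V) ⟨hV, hxV⟩ ⟨hyU, fun h => hsub h rfl⟩
      refine measure_mono_null hsub ((measure_biUnion_null_iff (hbc.mono fun V hV => hV.1)).2 ?_)
      rintro V ⟨hV, hxV⟩
      refine (h0 V hV).resolve_left fun h => ?_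
      have := hx1.trans (measure_mono (Set.singleton_subset_iff.2 (show x ∈ U ∩ V from ⟨hx, hxV⟩)))
      simp [h] at this
  rw [this]
  refine (PointConfig.measurable_apply hU measurableSet_Ici).inter
    (MeasurableSet.biInter hbc fun V hV => ?_)
  exact (PointConfig.measurable_apply (hU.inter (hbm V hV)) (measurableSet_singleton 0)).union
    (PointConfig.measurable_apply (hU.diff (hbm V hV)) (measurableSet_singleton 0))

/-- Points of a configuration can be isolated by small basic open sets. -/
theorem exists_isolatedIn [BorelSpace S] {b : Set (Set S)}
    (hb : TopologicalSpace.IsTopologicalBasis b) (N : PointConfig S) {x : S} (hx : 1 ≤ N.1 {x})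
    {W : Set S} (hW : IsOpen W) (hxW : x ∈ W) : ∃ U ∈ b, U ⊆ W ∧ IsolatedIn U N := by
  obtain ⟨I, z, hz, hfin⟩ := N.exists_sum_dirac_finite_preimage
  have := N.2.1
  obtain ⟨V, hxV, hV, hVfin⟩ := N.1.exists_isOpen_measure_lt_top x
  -- Only finitely many places in `V` are occupied, so removing those other than `x` leaves an open
  -- neighbourhood of `x`.
  have hF : (z '' (z ⁻¹' V) \ {x}).Finite := ((hfin V hV.measurableSet hVfin).image z).subset
    Set.sdiff_subset
  obtain ⟨U, hU, hxU, hsub⟩ := hb.exists_subset_of_mem_open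
    (show x ∈ (W ∩ V) \ (z '' (z ⁻¹' V) \ {x}) from ⟨⟨hxW, hxV⟩, fun h => h.2 rfl⟩)
    ((hW.inter hV).sdiff hF.isClosed)
  refine ⟨U, hU, fun y hy => (hsub hy).1.1, x, hxU, hx, ?_⟩
  rw [hz]
  by_contra h
  obtain ⟨i, hiU, hix⟩ := (sum_dirac_ne_zero_iff z
    ((hb.isOpen hU).measurableSet.diff (measurableSet_singleton x))).1 h
  exact (hsub hiU).2 ⟨⟨i, (hsub hiU).1.2, rfl⟩, hix⟩

omit [MetricSpace S] in
-- The additive form avoids subtraction, as the mass of `B` may be infinite.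
theorem sum_dirac_update_apply {ι : Type*} [DecidableEq ι] (z : ι → S) (i : ι) (a : S)
    {B : Set S} (hB : MeasurableSet B) :
    Measure.sum (fun j => Measure.dirac (Function.update z i a j)) B + B.indicator 1 (z i) =
      Measure.sum (fun j => Measure.dirac (z j)) B + B.indicator 1 a := by
  rw [Measure.sum_apply _ hB, Measure.sum_apply _ hB]
  simp only [Measure.dirac_apply' _ hB]
  rw [ENNReal.tsum_eq_add_tsum_ite i,
    ENNReal.tsum_eq_add_tsum_ite (f := fun j => B.indicator 1 (z j)) i,
    Function.update_self, add_right_comm, add_comm (B.indicator 1 a), add_right_comm]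
  congr 2
  refine tsum_congr fun j => ?_
  split_ifs with hj
  · rfl
  · rw [Function.update_of_ne hj]

/-- Moving one point of `N` from `U` to `a`. -/
theorem exists_move_point [BorelSpace S] {U : Set S} (hU : MeasurableSet U) (a : S)
    {N : PointConfig S} (h : IsolatedIn U N) :
    ∃ N' : PointConfig S,
      (∀ B, MeasurableSet B → N'.1 B = N.1 B - (if 1 ≤ N.1 (B ∩ U) then 1 else 0) +
        B.indicator 1 a) ∧
      matchingCost N' N ≤ ⨆ x ∈ U, edist x a ∧
      (N.1 Set.univ < ∞ → finiteCost N' N ≤ ⨆ x ∈ U, edist x a) := by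
  classical
  obtain ⟨x, hxU, hx1, hx0⟩ := h
  obtain ⟨I, z, hz, hfin⟩ := N.exists_sum_dirac_finite_preimage
  obtain ⟨i, hi⟩ : ∃ i, z i ∈ ({x} : Set S) := by
    rwa [hz, one_le_sum_dirac_iff z (measurableSet_singleton x)] at hx1
  rw [Set.mem_singleton_iff] at hi
  set y := Function.update z i a with hy
  have hval : ∀ B, MeasurableSet B → Measure.sum (fun j => Measure.dirac (y j)) B =
      N.1 B - (if 1 ≤ N.1 (B ∩ U) then 1 else 0) + B.indicator 1 a := by
    intro B hB
    -- Isolation lets the removed unit mass be read off from `N (B ∩ U)`, without naming `x`; this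
    -- makes the move measurable in `N`.
    have h1 : (if 1 ≤ N.1 (B ∩ U) then (1 : ℝ≥0∞) else 0) = B.indicator 1 x := by
      by_cases hxB : x ∈ B
      · rw [if_pos ((N.one_le_iff_exists (hB.inter hU)).2 ⟨x, ⟨hxB, hxU⟩, hx1⟩)]
        simp [hxB]
      · rw [if_neg]
        · simp [hxB]
        · rw [measure_mono_null (t := U \ {x}) (fun w hw => ⟨hw.2, fun hwx => hxB (hwx ▸ hw.1)⟩) hx0]
          simp
    rw [h1, hz, ← hi, ENNReal.sub_add_eq_add_sub, ← sum_dirac_update_apply z i a hB,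
      ENNReal.add_sub_cancel_right]
    · by_cases hxB : z i ∈ B <;> simp [hxB]
    · rw [Measure.sum_apply _ hB]
      refine le_trans ?_ (ENNReal.le_tsum i)
      rw [Measure.dirac_apply' _ hB]
    · by_cases hxB : z i ∈ B <;> simp [hxB]
  have hcost : ∑' j, edist (y j) (z j) ≤ ⨆ x ∈ U, edist x a := by
    rw [tsum_eq_single i fun j hj => by rw [hy, Function.update_of_ne hj, edist_self]]
    rw [hy, Function.update_self, hi, edist_comm]
    exact le_iSup₂ (f := fun x (_ : x ∈ U) => edist x a) x hxU
  have hle : Measure.sum (fun j => Measure.dirac (y j)) ≤ N.1 + Measure.dirac a := by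
    refine Measure.le_iff.2 fun B hB => ?_
    rw [hval B hB, Measure.add_apply, Measure.dirac_apply' _ hB]
    gcongr
    exact tsub_le_self
  have hloc : IsLocallyFiniteMeasure (Measure.sum (fun j => Measure.dirac (y j))) := by
    have := N.2.1
    refine ⟨fun w => ?_⟩
    obtain ⟨V, hV, hVfin⟩ := N.1.finiteAt_nhds w
    refine ⟨V, hV, (hle V).trans_lt ?_⟩
    rw [Measure.add_apply]
    exact ENNReal.add_lt_top.2 ⟨hVfin, measure_lt_top _ _⟩
  refine ⟨⟨_, hloc, I, y, rfl⟩, hval, (matchingCost_le_tsum rfl hz).trans hcost, fun hN => ?_⟩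
  have : Finite I := Set.finite_univ_iff.1 (by simpa using hfin _ MeasurableSet.univ hN)
  exact (finiteCost_le_tsum rfl hz).trans hcost


end Configurations

/-! ### The continuous knapsack problem -/

section Knapsack

open Filter Topology

variable {Ω : Type*} [MeasurableSpace Ω]

/-- Take for `t` the least level at which `ν {D ≤ t}` reaches `δ`. Continuity from above (using
`hfin`) shows that it is reached at `t`, continuity from below that `{D < t}` stays within `δ`; `h0`
excludes `t = 0`. -/
theorem exists_threshold (ν : Measure Ω) {D : Ω → ℝ≥0∞} (hD : Measurable D) {δ : ℝ≥0}
    (hfin : ∀ t : ℝ≥0, ν {ω | D ω ≤ t} ≠ ∞) (hlt : δ < ν {ω | D ω < ∞})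
    (h0 : ν {ω | D ω = 0} < δ) :
    ∃ t : ℝ≥0, 0 < t ∧ ν {ω | D ω < t} ≤ δ ∧ δ ≤ ν {ω | D ω ≤ t} := by
  have hm : ∀ t : ℝ≥0∞, MeasurableSet {ω | D ω ≤ t} := fun t => hD measurableSet_Iic
  let s : Set ℝ≥0 := {t | δ ≤ ν {ω | D ω ≤ t}}
  have hne : s.Nonempty := by
    have hU : {ω | D ω < ∞} = ⋃ n : ℕ, {ω | D ω ≤ (n : ℝ≥0)} := by
      ext ω
      simp only [Set.mem_ofPred_eq, Set.mem_iUnion]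
      refine ⟨fun h => ?_, fun ⟨n, h⟩ => h.trans_lt ENNReal.coe_lt_top⟩
      obtain ⟨n, hn⟩ := ENNReal.exists_nat_gt h.ne
      exact ⟨n, by simpa using hn.le⟩
    have hmono : Monotone fun n : ℕ => {ω | D ω ≤ (n : ℝ≥0)} := fun m n hmn ω
      (h : D ω ≤ _) => show D ω ≤ _ from h.trans (by exact_mod_cast hmn)
    have ht := tendsto_measure_iUnion_atTop (μ := ν) hmono
    rw [← hU] at ht
    obtain ⟨n, hn⟩ := (ht.eventually (lt_mem_nhds hlt)).exists
    exact ⟨n, hn.le⟩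
  have hbdd : BddBelow s := OrderBot.bddBelow s
  let t := sInf s
  have hts : δ ≤ ν {ω | D ω ≤ t} := by
    obtain ⟨u, hu, hut, hlim⟩ := exists_seq_strictAnti_tendsto t
    have hI : {ω | D ω ≤ t} = ⋂ n, {ω | D ω ≤ u n} := by
      ext ω
      simp only [Set.mem_ofPred_eq, Set.mem_iInter]
      refine ⟨fun h n => h.trans (by exact_mod_cast (hut n).le), fun h => ?_⟩
      exact ge_of_tendsto' (ENNReal.tendsto_coe.2 hlim) h
    have ht := tendsto_measure_iInter_atTop (μ := ν)
      (fun n => (hm (u n)).nullMeasurableSet)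
      (fun m n hmn ω (h : D ω ≤ _) => show D ω ≤ _ from h.trans (by exact_mod_cast hu.antitone hmn))
      ⟨0, hfin (u 0)⟩
    rw [← hI] at ht
    refine ge_of_tendsto' ht fun n => ?_
    obtain ⟨r, hr, hru⟩ := (csInf_lt_iff hbdd hne).1 (hut n)
    exact hr.trans (measure_mono fun ω (h : D ω ≤ _) =>
      show D ω ≤ _ from h.trans (by exact_mod_cast hru.le))
  have hpos : 0 < t := by
    rw [pos_iff_ne_zero]
    intro h
    rw [h] at hts
    refine (hts.trans_lt (lt_of_le_of_lt (measure_mono fun ω h => ?_) h0)).false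
    simpa using h
  refine ⟨t, hpos, ?_, hts⟩
  obtain ⟨u, hu, hut, hlim⟩ := exists_seq_strictMono_tendsto' hpos
  have hU : {ω | D ω < t} = ⋃ n, {ω | D ω ≤ u n} := by
    ext ω
    simp only [Set.mem_ofPred_eq, Set.mem_iUnion]
    refine ⟨fun h => ?_, fun ⟨n, h⟩ => h.trans_lt (by exact_mod_cast (hut n).2)⟩
    obtain ⟨n, hn⟩ := ((ENNReal.tendsto_coe.2 hlim).eventually (lt_mem_nhds h)).exists
    exact ⟨n, hn.le⟩
  have ht := tendsto_measure_iUnion_atTop (μ := ν) (s := fun n => {ω | D ω ≤ u n})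
    (fun m n hmn ω (h : D ω ≤ _) => show D ω ≤ _ from h.trans (by exact_mod_cast hu.monotone hmn))
  rw [← hU] at ht
  exact le_of_tendsto' ht fun n => (not_le.1 (notMem_of_lt_csInf (s := s) (hut n).2 hbdd)).le

/-- The continuous knapsack problem: the dual value is attained by a randomized set of points
of total cost at most `δ`. -/
theorem exists_knapsack (μ : Measure Ω) [IsProbabilityMeasure μ] {D : Ω → ℝ≥0∞}
    (hD : Measurable D) {δ : ℝ≥0} (hδ : 0 < δ) :
    ∃ φ : Ω → ℝ≥0∞, Measurable φ ∧ (∀ ω, φ ω ≤ 1) ∧ (∀ ω, D ω = ∞ → φ ω = 0) ∧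
      ∫⁻ ω, φ ω * D ω ∂μ ≤ δ ∧
      ⨅ l : ℝ≥0, ((l : ℝ≥0∞) * δ + ∫⁻ ω, (1 - (l : ℝ≥0∞) * D ω) ∂μ) ≤ ∫⁻ ω, φ ω ∂μ := by
  -- `ν B` is the cost of selecting all of `B`.
  let ν := μ.withDensity D
  have hν : ∀ B, MeasurableSet B → ν B = ∫⁻ ω, B.indicator 1 ω * D ω ∂μ := by
    intro B hB
    rw [withDensity_apply _ hB, ← lintegral_indicator hB]
    refine lintegral_congr fun ω => ?_
    by_cases h : ω ∈ B <;> simp [h]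
  rcases le_or_gt (ν {ω | D ω < ∞}) δ with hle | hlt
  · have hm : MeasurableSet {ω | D ω < ∞} := hD measurableSet_Iio
    refine ⟨{ω | D ω < ∞}.indicator 1, measurable_one.indicator hm,
      fun ω => Set.indicator_le_self' (by simp) ω, fun ω h => by simp [h],
      (hν _ hm).symm.trans_le hle, ?_⟩
    refine ENNReal.le_of_forall_pos_le_add fun ε hε _ => ?_
    -- Everything at finite distance is affordable, so the multiplier tends to zero; it stays
    -- positive to annihilate `{D = ∞}`.
    refine iInf_le_of_le (ε / δ) ?_
    rw [← ENNReal.coe_mul, div_mul_cancel₀ _ hδ.ne', add_comm]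
    gcongr with ω
    by_cases h : D ω < ∞
    · simp [h]
    · have hl : ((ε / δ : ℝ≥0) : ℝ≥0∞) ≠ 0 := by
        simpa using ⟨hε.ne', hδ.ne'⟩
      rw [not_lt_top_iff.1 h, ENNReal.mul_top hl]
      simp
  · have hfin : ∀ t : ℝ≥0, ν {ω | D ω ≤ t} ≠ ∞ := by
      intro t
      rw [hν {ω | D ω ≤ t} (hD measurableSet_Iic)]
      refine ne_top_of_le_ne_top (b := (t : ℝ≥0∞)) ENNReal.coe_ne_top ?_
      refine (lintegral_mono fun ω => ?_ : _ ≤ ∫⁻ _, (t : ℝ≥0∞) ∂μ).trans (by simp)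
      by_cases h : D ω ≤ t <;> simp [h]
    have h0 : ν {ω | D ω = 0} < δ := by
      rw [hν {ω | D ω = 0} (hD (measurableSet_singleton 0))]
      refine lt_of_eq_of_lt ?_ (ENNReal.coe_pos.2 hδ)
      refine (lintegral_congr fun ω => ?_).trans lintegral_zero
      by_cases h : D ω = 0 <;> simp [h]
    obtain ⟨t, ht, h1, h2⟩ := exists_threshold ν hD hfin hlt h0
    have hmlt : MeasurableSet {ω | D ω < t} := hD measurableSet_Iio
    have hmeq : MeasurableSet {ω | D ω = t} := hD (measurableSet_singleton _)
    have h3 : ν {ω | D ω ≤ t} = ν {ω | D ω < t} + ν {ω | D ω = t} := by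
      rw [← measure_union _ hmeq]
      · congr 1
        ext ω
        exact le_iff_lt_or_eq (a := D ω)
      · exact Set.disjoint_left.2 fun ω h h' => (ne_of_lt h) h'
    have hne : ν {ω | D ω = t} ≠ ∞ :=
      ne_top_of_le_ne_top (hfin t) (measure_mono fun ω h => le_of_eq h)
    -- The fraction of the level set `D = t` that spends exactly the remaining budget; if that level
    -- set is `ν`-null, nothing remains.
    set θ := (δ - ν {ω | D ω < t}) / ν {ω | D ω = t} with hθ
    have hgap : δ - ν {ω | D ω < t} ≤ ν {ω | D ω = t} := tsub_le_iff_left.2 (h3 ▸ h2)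
    have hθ1 : θ ≤ 1 := ENNReal.div_le_of_le_mul (by rwa [one_mul])
    have hθm : θ * ν {ω | D ω = t} = δ - ν {ω | D ω < t} := by
      by_cases hz : ν {ω | D ω = t} = 0
      · rw [hz, mul_zero]
        exact (le_zero_iff.1 (hz ▸ hgap)).symm
      · exact ENNReal.div_mul_cancel hz hne
    let φ : Ω → ℝ≥0∞ := fun ω => {ω | D ω < t}.indicator 1 ω + θ * {ω | D ω = t}.indicator 1 ω
    have hmlt' : Measurable ({ω | D ω < t}.indicator (1 : Ω → ℝ≥0∞)) :=
      measurable_one.indicator hmlt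
    have hmeq' : Measurable ({ω | D ω = t}.indicator (1 : Ω → ℝ≥0∞)) :=
      measurable_one.indicator hmeq
    have hφ : Measurable φ := hmlt'.add (hmeq'.const_mul θ)
    have hcost : ∫⁻ ω, φ ω * D ω ∂μ = δ := by
      simp only [φ, add_mul, mul_assoc]
      rw [lintegral_add_left (f := fun ω => _ * _) (hmlt'.mul hD),
        lintegral_const_mul _ (f := fun ω => _ * _) (hmeq'.mul hD), ← hν _ hmlt,
        ← hν _ hmeq, hθm, add_tsub_cancel_of_le h1]
    refine ⟨φ, hφ, fun ω => ?_, fun ω h => ?_, hcost.le, ?_⟩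
    · rcases lt_trichotomy (D ω) t with h | h | h
      · simp [φ, h, h.ne]
      · simpa [φ, h] using hθ1
      · simp [φ, h.not_gt, h.ne']
    · simp [φ, h]
    -- Complementary slackness: `φ * D / t + (1 - D / t)⁺` equals `φ` pointwise, in each of the
    -- cases `D < t`, `D = t`, `D > t`.
    · refine iInf_le_of_le t⁻¹ ?_
      have hmD : Measurable fun ω => φ ω * D ω := hφ.mul hD
      rw [← hcost, ← lintegral_const_mul _ hmD,
        ← lintegral_add_left (hmD.const_mul _)]
      refine lintegral_mono fun ω => ?_
      have hinv : ((t⁻¹ : ℝ≥0) : ℝ≥0∞) * t = 1 := by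
        rw [← ENNReal.coe_mul, inv_mul_cancel₀ ht.ne', ENNReal.coe_one]
      rcases lt_trichotomy (D ω) t with h | h | h
      · have h4 : ((t⁻¹ : ℝ≥0) : ℝ≥0∞) * D ω ≤ 1 := hinv ▸ by gcongr
        simp [φ, h, h.ne, add_tsub_cancel_of_le h4]
      · simp only [φ, h]
        rw [mul_left_comm, hinv]
        simp
      · have h4 : 1 ≤ ((t⁻¹ : ℝ≥0) : ℝ≥0∞) * D ω := hinv ▸ by gcongr
        simp [φ, h.not_gt, h.ne', tsub_eq_zero_of_le h4]

/-- The dual value at radius zero. -/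
theorem iInf_lintegral_one_sub_mul_le (μ : Measure Ω) [IsProbabilityMeasure μ] {D : Ω → ℝ≥0∞}
    (hD : Measurable D) :
    ⨅ l : ℝ≥0, ∫⁻ ω, (1 - (l : ℝ≥0∞) * D ω) ∂μ ≤ μ {ω | D ω = 0} := by
  have hm : MeasurableSet {ω | D ω = 0} := hD (measurableSet_singleton 0)
  -- Along integer multipliers the integrands are bounded by `1`, and vanish eventually wherever `D
  -- > 0`.
  have ht : Tendsto (fun n : ℕ => ∫⁻ ω, (1 - ((n : ℝ≥0) : ℝ≥0∞) * D ω) ∂μ) atTop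
      (𝓝 (∫⁻ ω, {ω | D ω = 0}.indicator 1 ω ∂μ)) := by
    refine tendsto_lintegral_of_dominated_convergence 1
      (fun n => measurable_const.sub (hD.const_mul _)) (fun n => ae_of_all _ fun ω => tsub_le_self)
      (by simp) (ae_of_all _ fun ω => ?_)
    by_cases h : D ω = 0
    · simp [h]
    · refine tendsto_const_nhds.congr' ?_
      obtain ⟨n, hn⟩ := ENNReal.exists_nat_mul_gt h ENNReal.one_ne_top
      filter_upwards [eventually_ge_atTop n] with k hk
      have : 1 ≤ (k : ℝ≥0∞) * D ω := hn.le.trans (by gcongr)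
      simp [h, tsub_eq_zero_of_le this]
  rw [lintegral_indicator_one hm] at ht
  exact ge_of_tendsto' ht fun n => iInf_le _ (n : ℝ≥0)

end Knapsack

/-! ### Measurable, nearly optimal transport maps -/

section Transport

variable {S : Type*} [MetricSpace S] [MeasurableSpace S] [BorelSpace S]

/-- The moved configuration may be picked by choice: its evaluations are given by a formula
measurable in `N`, and these determine measurability. -/
theorem exists_measurable_move_point [SecondCountableTopology S] {U : Set S}
    (hU : MeasurableSet U) (a : S) :
    ∃ T : PointConfig S → PointConfig S, Measurable T ∧ ∀ N, IsolatedIn U N →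
      (T N).1 {a} ≠ 0 ∧ matchingCost (T N) N ≤ ⨆ x ∈ U, edist x a ∧
      (N.1 Set.univ < ∞ → finiteCost (T N) N ≤ ⨆ x ∈ U, edist x a) := by
  classical
  choose! T hT using fun N h => exists_move_point hU a (N := N) h
  refine ⟨fun N => if IsolatedIn U N then T N else N, ?_, fun N hN => ?_⟩
  · refine Measurable.subtype_mk (f := fun N => (if IsolatedIn U N then T N else N).1)
      (Measure.measurable_of_measurable_coe _ fun B hB => ?_)
    have heq : (fun N : PointConfig S => (if IsolatedIn U N then T N else N).1 B) = fun N =>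
        if IsolatedIn U N then N.1 B - (if 1 ≤ N.1 (B ∩ U) then 1 else 0) + B.indicator 1 a
        else N.1 B := by
      funext N
      split_ifs with h h'
      · rw [(hT N h).1 B hB, if_pos h']
      · rw [(hT N h).1 B hB, if_neg h']
      · rfl
    rw [heq]
    refine Measurable.ite (measurableSet_isolatedIn hU) ?_ (PointConfig.measurable_apply hB)
    refine ((PointConfig.measurable_apply hB).sub (Measurable.ite ?_ measurable_const
      measurable_const)).add_const _
    exact PointConfig.measurable_apply (hB.inter hU) measurableSet_Ici
  · simp only [if_pos hN]
    refine ⟨?_, (hT N hN).2⟩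
    rw [(hT N hN).1 {a} (measurableSet_singleton a)]
    simp

/-- Gluing countably many measurable maps, each used on a measurable set. -/
theorem exists_measurable_selection {X Y ι : Type*} [MeasurableSpace X] [MeasurableSpace Y]
    [Countable ι] (T : ι → X → Y) (hT : ∀ i, Measurable (T i)) {T₀ : X → Y} (hT₀ : Measurable T₀)
    (s : ι → Set X) (hs : ∀ i, MeasurableSet (s i)) :
    ∃ f : X → Y, Measurable f ∧ ∀ x ∈ ⋃ i, s i, ∃ i, x ∈ s i ∧ f x = T i x := by
  classical
  rcases isEmpty_or_nonempty ι with h | h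
  · exact ⟨T₀, hT₀, by simp⟩
  obtain ⟨e, he⟩ := exists_surjective_nat ι
  -- The second alternative only makes the search succeed outside the union, where the value is
  -- irrelevant.
  let p : ℕ → X → Prop := fun n x => x ∈ s (e n) ∨ x ∉ ⋃ i, s i
  have hp : ∀ x, ∃ n, p n x := by
    intro x
    by_cases hx : x ∈ ⋃ i, s i
    · obtain ⟨i, hi⟩ := Set.mem_iUnion.1 hx
      obtain ⟨n, rfl⟩ := he i
      exact ⟨n, .inl hi⟩
    · exact ⟨0, .inr hx⟩
  refine ⟨_, Measurable.find (f := fun n => T (e n)) (p := p) (fun n => hT _)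
    (fun n => (hs (e n)).union (MeasurableSet.iUnion hs).compl) hp, fun x hx => ?_⟩
  exact ⟨e (Nat.find (hp x)), (Nat.find_spec (hp x)).resolve_right (not_not.2 hx), rfl⟩

/-- Moving one point of `N` into `A`, at a cost that is optimal up to `ε`. -/
theorem exists_measurable_transport [SecondCountableTopology S] {A : Set S}
    (hA : MeasurableSet A) {ε : ℝ≥0∞} (hε : ε ≠ 0) :
    ∃ T : PointConfig S → PointConfig S, Measurable T ∧ ∀ N, distToSet N A < ∞ →
      1 ≤ (T N).1 A ∧ matchingCost (T N) N ≤ distToSet N A + ε ∧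
      (N.1 Set.univ < ∞ → finiteCost (T N) N ≤ distToSet N A + ε) := by
  have hb := TopologicalSpace.isBasis_countableBasis S
  obtain ⟨s, hsA, hsc, hs⟩ :=
    (TopologicalSpace.IsSeparable.of_separableSpace A).exists_countable_dense_subset
  let ι := TopologicalSpace.countableBasis S × s
  have : Countable s := hsc
  have hm : ∀ i : ι, MeasurableSet i.1.1 := fun i => (hb.isOpen i.1.2).measurableSet
  choose T hT hTU using fun i : ι => exists_measurable_move_point (hm i) i.2.1
  -- Bounding the distance to `a` uniformly over `U` avoids reference to the moved point, so only
  -- `distToSet N A` depends on `N`. The slack `ε` lets `a` range over a countable dense subset of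
  -- `A`.
  let G : ι → Set (PointConfig S) := fun i =>
    {N | IsolatedIn i.1.1 N} ∩ {N | ⨆ x ∈ i.1.1, edist x i.2.1 ≤ distToSet N A + ε}
  obtain ⟨f, hf, hfG⟩ := exists_measurable_selection T hT measurable_id G fun i =>
    (measurableSet_isolatedIn (hm i)).inter
      (measurableSet_le measurable_const ((measurable_distToSet A).add_const ε))
  refine ⟨f, hf, fun N hN => ?_⟩
  have hNG : N ∈ ⋃ i, G i := by
    have hlt : distToSet N A < distToSet N A + ε := ENNReal.lt_add_right hN.ne hε
    nth_rewrite 1 [distToSet] at hlt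
    simp only [iInf_lt_iff] at hlt
    obtain ⟨x, hx, y, hy, hxy⟩ := hlt
    obtain ⟨a, ha, hya⟩ := EMetric.mem_closure_iff.1 (hs hy) _ (tsub_pos_of_lt hxy)
    have hxa : edist x a < distToSet N A + ε := by
      refine (edist_triangle x y a).trans_lt ?_
      rw [edist_comm x y, add_comm]
      exact lt_tsub_iff_right.1 hya
    obtain ⟨U, hU, hUW, hUN⟩ := exists_isolatedIn hb N hx
      (isOpen_lt (continuous_id.edist continuous_const) continuous_const) hxa
    exact Set.mem_iUnion.2 ⟨(⟨U, hU⟩, ⟨a, ha⟩), hUN,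
      show ⨆ x ∈ U, edist x a ≤ distToSet N A + ε from iSup₂_le fun z hz => (hUW hz).le⟩
  obtain ⟨i, ⟨hi, hic⟩, hfi⟩ := hfG N hNG
  obtain ⟨h1, h2, h3⟩ := hTU i N hi
  rw [hfi]
  refine ⟨?_, h2.trans hic, fun h => (h3 h).trans hic⟩
  rw [PointConfig.one_le_iff_ne_zero _ hA]
  exact fun h => h1 (measure_mono_null (Set.singleton_subset_iff.2 (hsA i.2.2)) h)

end Transport

/-! ### Weak and strong duality -/

section Duality

variable {S : Type*} [MetricSpace S] [MeasurableSpace S] [BorelSpace S]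

/-- Weak duality. -/
theorem worstCaseHitProb_le_rareSetDual {c : PointConfig S → PointConfig S → ℝ≥0∞} {A : Set S}
    (hA : MeasurableSet A) (hc : ∀ N N', 1 ≤ N.1 A → distToSet N' A ≤ c N N')
    (P₀ : Measure (PointConfig S)) (δ : ℝ≥0) :
    worstCaseHitProb c P₀ δ A ≤ rareSetDual P₀ δ A := by
  refine iSup_le fun P => iSup₂_le fun hP hW => le_iInf fun l => ?_
  have hH : MeasurableSet {N : PointConfig S | 1 ≤ N.1 A} :=
    PointConfig.measurable_apply hA measurableSet_Ici
  have hmeas : Measurable fun N : PointConfig S => 1 - (l : ℝ≥0∞) * distToSet N A :=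
    measurable_const.sub ((measurable_distToSet A).const_mul _)
  have key : ∀ γ : Measure (PointConfig S × PointConfig S), γ.map Prod.fst = P →
      γ.map Prod.snd = P₀ → P {N | 1 ≤ N.1 A} ≤ l * ∫⁻ z, c z.1 z.2 ∂γ +
        ∫⁻ N, (1 - (l : ℝ≥0∞) * distToSet N A) ∂P₀ := by
    rintro γ rfl rfl
    rw [Measure.map_apply measurable_fst hH, ← lintegral_indicator_one (measurable_fst hH),
      lintegral_map hmeas measurable_snd, ← lintegral_const_mul' _ _ ENNReal.coe_ne_top,
      ← lintegral_add_right
        (g := fun z : PointConfig S × PointConfig S => 1 - (l : ℝ≥0∞) * distToSet z.2 A)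
        _ (hmeas.comp measurable_snd)]
    refine lintegral_mono fun z => ?_
    by_cases hz : 1 ≤ z.1.1 A
    · rw [Set.indicator_of_mem (show z ∈ Prod.fst ⁻¹' {N : PointConfig S | 1 ≤ N.1 A} from hz)]
      exact le_add_tsub.trans (add_le_add_left (mul_le_mul_right (hc _ _ hz) _) _)
    · rw [Set.indicator_of_notMem (show z ∉ Prod.fst ⁻¹' {N : PointConfig S | 1 ≤ N.1 A} from hz)]
      exact zero_le
  -- The infimum over couplings is handled by dividing by `l`. For `l = 0` any one coupling
  -- suffices, and one exists since the transport cost is finite.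
  rcases eq_or_ne l 0 with rfl | hl
  · by_cases hγ : ∃ γ : Measure (PointConfig S × PointConfig S),
      γ.map Prod.fst = P ∧ γ.map Prod.snd = P₀
    · obtain ⟨γ, h1, h2⟩ := hγ
      simpa using key γ h1 h2
    · have : wassersteinCost c P P₀ = ∞ := by
        simp only [wassersteinCost, iInf_eq_top]
        exact fun γ h1 h2 => absurd ⟨γ, h1, h2⟩ hγ
      simp [this] at hW
  · refine le_trans ?_ (add_le_add_left (mul_le_mul_right hW (l : ℝ≥0∞)) _)
    have hl' : (l : ℝ≥0∞) ≠ 0 := ENNReal.coe_ne_zero.2 hl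
    rw [← tsub_le_iff_right, mul_comm, ← ENNReal.div_le_iff hl' ENNReal.coe_ne_top]
    refine le_iInf fun γ => le_iInf₂ fun h1 h2 => ?_
    rw [ENNReal.div_le_iff hl' ENNReal.coe_ne_top, tsub_le_iff_right, mul_comm]
    exact key γ h1 h2

omit [BorelSpace S] in
/-- Moving a random part `φ` of the configurations along `T`. -/
theorem le_worstCaseHitProb_of_transport {c : PointConfig S → PointConfig S → ℝ≥0∞} {A : Set S}
    (hA : MeasurableSet A) (P₀ : Measure (PointConfig S)) [IsProbabilityMeasure P₀] {δ : ℝ≥0}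
    (hc : ∀ᵐ N ∂P₀, c N N = 0) {T : PointConfig S → PointConfig S} (hT : Measurable T)
    {φ : PointConfig S → ℝ≥0∞} (hφ : Measurable φ) (hφ1 : ∀ N, φ N ≤ 1)
    (hTA : ∀ᵐ N ∂P₀, φ N ≠ 0 → 1 ≤ (T N).1 A) (hcost : ∫⁻ N, φ N * c (T N) N ∂P₀ ≤ δ) :
    ∫⁻ N, φ N ∂P₀ ≤ worstCaseHitProb c P₀ δ A := by
  set μ₁ := P₀.withDensity φ with hμ₁
  set μ₂ := P₀.withDensity (fun N => 1 - φ N) with hμ₂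
  have hadd : μ₁ + μ₂ = P₀ := by
    rw [hμ₁, hμ₂, ← withDensity_add_left hφ]
    convert withDensity_one (μ := P₀) using 2
    funext N
    exact add_tsub_cancel_of_le (hφ1 N)
  -- The part `φ` moves along `T`; the rest stays on the diagonal, where the cost vanishes almost
  -- everywhere.
  let γ := μ₁.map (fun N => (T N, N)) + μ₂.map (fun N => (N, N))
  have hf : Measurable fun N : PointConfig S => (T N, N) := hT.prodMk measurable_id
  have hg : Measurable fun N : PointConfig S => (N, N) := measurable_id.prodMk measurable_id
  have hsnd : γ.map Prod.snd = P₀ := by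
    rw [Measure.map_add _ _ measurable_snd, Measure.map_map measurable_snd hf,
      Measure.map_map measurable_snd hg]
    exact (congr_arg₂ _ Measure.map_id Measure.map_id).trans hadd
  have hprob : IsProbabilityMeasure γ := by
    refine ⟨?_⟩
    rw [← Set.preimage_univ (f := Prod.snd), ← Measure.map_apply measurable_snd .univ, hsnd,
      measure_univ]
  have hH : MeasurableSet {N : PointConfig S | 1 ≤ N.1 A} :=
    PointConfig.measurable_apply hA measurableSet_Ici
  have hlt : ∀ᵐ N ∂P₀, φ N < ∞ := ae_of_all _ fun N => (hφ1 N).trans_lt ENNReal.one_lt_top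
  have hW : wassersteinCost c (γ.map Prod.fst) P₀ ≤ δ := by
    refine (iInf_le_of_le γ <| iInf_le_of_le rfl <| iInf_le _ hsnd).trans ?_
    rw [lintegral_add_measure]
    -- Only upper bounds are used here, so `c` need not be measurable.
    refine (add_le_add (lintegral_map_le _ _) (lintegral_map_le _ _)).trans ?_
    rw [lintegral_withDensity_eq_lintegral_mul_non_measurable _ hφ hlt,
      (lintegral_congr_ae ((withDensity_absolutelyContinuous _ _).ae_le hc) :
        ∫⁻ N, c N N ∂μ₂ = ∫⁻ _, 0 ∂μ₂), lintegral_zero, add_zero]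
    exact hcost
  refine le_trans ?_ (le_iSup_of_le (γ.map Prod.fst) <| le_iSup_of_le
    (Measure.isProbabilityMeasure_map measurable_fst.aemeasurable) <| le_iSup_of_le hW le_rfl)
  rw [Measure.map_add _ _ measurable_fst, Measure.map_map measurable_fst hf]
  refine le_trans ?_ (Measure.le_add_right (μ := Measure.map (Prod.fst ∘ fun N => (T N, N)) μ₁)
    le_rfl _)
  rw [Measure.map_apply (measurable_fst.comp hf) hH]
  change _ ≤ P₀.withDensity φ (T ⁻¹' {N | 1 ≤ N.1 A})
  rw [withDensity_apply _ (hT hH), ← lintegral_indicator (hT hH)]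
  refine lintegral_mono_ae ?_
  filter_upwards [hTA] with N hN
  by_cases h : φ N = 0
  · simp [h]
  · rw [Set.indicator_of_mem]
    exact hN h

theorem rareSetDual_le_worstCaseHitProb {c : PointConfig S → PointConfig S → ℝ≥0∞} {A : Set S}
    (hA : MeasurableSet A) (P₀ : Measure (PointConfig S)) [IsProbabilityMeasure P₀] {δ : ℝ≥0}
    (hδ : 0 < δ) (hc : ∀ᵐ N ∂P₀, c N N = 0)
    (hT : ∀ ε : ℝ≥0∞, ε ≠ 0 → ∃ T : PointConfig S → PointConfig S, Measurable T ∧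
      ∀ᵐ N ∂P₀, distToSet N A < ∞ → 1 ≤ (T N).1 A ∧ c (T N) N ≤ distToSet N A + ε) :
    rareSetDual P₀ δ A ≤ worstCaseHitProb c P₀ δ A := by
  obtain ⟨φ, hφ, hφ1, hφD, hφδ, hdual⟩ := exists_knapsack P₀ (measurable_distToSet A) hδ
  refine hdual.trans (ENNReal.le_of_forall_lt_one_mul_le fun s hs => ?_)
  -- Scaling `φ` by `s < 1` frees the budget `(1 - s) * δ`, which covers the error of a nearly
  -- optimal transport.
  have hε : (1 - s) * δ ≠ 0 :=
    mul_ne_zero (tsub_pos_of_lt hs).ne' (ENNReal.coe_pos.2 hδ).ne'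
  obtain ⟨T, hTm, hTN⟩ := hT _ hε
  rw [← lintegral_const_mul _ hφ]
  refine le_worstCaseHitProb_of_transport hA P₀ hc hTm (hφ.const_mul s)
    (fun N => mul_le_one' hs.le (hφ1 N)) ?_ ?_
  · filter_upwards [hTN] with N hN h
    exact (hN (lt_top_iff_ne_top.2 fun hD => h (by simp [hφD N hD]))).1
  · calc ∫⁻ N, s * φ N * c (T N) N ∂P₀
        ≤ ∫⁻ N, (s * (φ N * distToSet N A) + (1 - s) * δ) ∂P₀ := by
          refine lintegral_mono_ae ?_
          filter_upwards [hTN] with N hN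
          by_cases h : φ N = 0
          · simp [h]
          · calc s * φ N * c (T N) N ≤ s * φ N * (distToSet N A + (1 - s) * δ) := by
                  gcongr
                  exact (hN (lt_top_iff_ne_top.2 fun hD => h (hφD N hD))).2
              _ ≤ s * (φ N * distToSet N A) + 1 * ((1 - s) * δ) := by
                  rw [mul_add, mul_assoc]
                  gcongr
                  exact mul_le_one' hs.le (hφ1 N)
              _ = _ := by rw [one_mul]
      _ = s * ∫⁻ N, φ N * distToSet N A ∂P₀ + (1 - s) * δ := by
          rw [lintegral_add_right _ measurable_const,
            lintegral_const_mul _ (f := fun N => φ N * distToSet N A)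
              (hφ.mul (measurable_distToSet A))]
          simp
      _ ≤ s * δ + (1 - s) * δ := by gcongr
      _ = δ := by rw [← add_mul, add_tsub_cancel_of_le hs.le, one_mul]

/-- With finitely many points near the closed set `A`, distance zero means a point in `A`. -/
theorem one_le_of_distToSet_eq_zero {A : Set S} (hA : IsClosed A) {N : PointConfig S} {r : ℝ}
    (hr : 0 < r) (hN : N.1 (Metric.thickening r A) < ∞) (h : distToSet N A = 0) : 1 ≤ N.1 A := by
  obtain ⟨I, x, hx, hfin⟩ := N.exists_sum_dirac_finite_preimage
  have hF := hfin _ Metric.isOpen_thickening.measurableSet hN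
  have hpt : ∀ ρ : ℝ≥0∞, 0 < ρ → ∃ i, Metric.infEDist (x i) A < ρ := by
    intro ρ hρ
    have h1 := (distToSet_lt_iff N A ρ).1 (h ▸ hρ)
    rwa [hx, one_le_sum_dirac_iff x (measurableSet_lt Metric.continuous_infEDist.measurable
      measurable_const)] at h1
  have hne : (x ⁻¹' Metric.thickening r A).Nonempty := by
    obtain ⟨i, hi⟩ := hpt _ (ENNReal.ofReal_pos.2 hr)
    exact ⟨i, hi⟩
  -- Finiteness gives a closest point in the thickening; at positive distance from `A` it would be
  -- beaten by a strictly closer one, also in the thickening.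
  obtain ⟨i, hi, hmin⟩ := Set.exists_min_image _ (fun i => Metric.infEDist (x i) A) hF hne
  have hi0 : Metric.infEDist (x i) A = 0 := by
    by_contra h0
    obtain ⟨j, hj⟩ := hpt _ (pos_iff_ne_zero.2 h0)
    exact (hmin j (hj.trans hi)).not_gt hj
  rw [hx, one_le_sum_dirac_iff x hA.measurableSet]
  exact ⟨i, (Metric.mem_iff_infEDist_zero_of_closed hA).2 hi0⟩

/-- No movement is needed: configurations at distance zero almost surely hit `A` already, so the
identity serves as transport. -/
theorem rareSetDual_zero_le_worstCaseHitProb {c : PointConfig S → PointConfig S → ℝ≥0∞}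
    {A : Set S} (hA : IsClosed A) (P₀ : Measure (PointConfig S)) [IsProbabilityMeasure P₀]
    (hc : ∀ᵐ N ∂P₀, c N N = 0)
    (hN : ∀ᵐ N ∂P₀, ∃ r : ℝ, 0 < r ∧ N.1 (Metric.thickening r A) < ∞) :
    rareSetDual P₀ 0 A ≤ worstCaseHitProb c P₀ 0 A := by
  have hH : MeasurableSet {N : PointConfig S | 1 ≤ N.1 A} :=
    PointConfig.measurable_apply hA.measurableSet measurableSet_Ici
  calc rareSetDual P₀ 0 A ≤ P₀ {N | distToSet N A = 0} := by
        simpa [rareSetDual] using iInf_lintegral_one_sub_mul_le P₀ (measurable_distToSet A)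
    _ ≤ P₀ {N | 1 ≤ N.1 A} := by
        refine measure_mono_ae ?_
        filter_upwards [hN] with N ⟨r, hr, hfin⟩ h
        exact one_le_of_distToSet_eq_zero hA hr hfin h
    _ = ∫⁻ N, {N : PointConfig S | 1 ≤ N.1 A}.indicator 1 N ∂P₀ :=
        (lintegral_indicator_one hH).symm
    _ ≤ worstCaseHitProb c P₀ 0 A := by
        refine le_worstCaseHitProb_of_transport hA.measurableSet P₀ hc measurable_id
          (measurable_one.indicator hH) (Set.indicator_le_self' (by simp)) ?_ ?_
        · exact ae_of_all _ fun N h =>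
            Set.mem_of_indicator_ne_zero (s := {N : PointConfig S | 1 ≤ N.1 A}) h
        · refine le_of_eq ((lintegral_congr_ae ?_).trans lintegral_zero)
          filter_upwards [hc] with N h
          simp [h]

theorem worstCaseHitProb_eq_rareSetDual {c : PointConfig S → PointConfig S → ℝ≥0∞} {A : Set S}
    (hA : MeasurableSet A) (P₀ : Measure (PointConfig S)) [IsProbabilityMeasure P₀] (δ : ℝ≥0)
    (hδ : 0 < δ ∨
      (IsClosed A ∧ ∀ᵐ N ∂P₀, ∃ r : ℝ, 0 < r ∧ N.1 (Metric.thickening r A) < ∞))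
    (hlow : ∀ N N', 1 ≤ N.1 A → distToSet N' A ≤ c N N') (hc : ∀ᵐ N ∂P₀, c N N = 0)
    (hT : ∀ ε : ℝ≥0∞, ε ≠ 0 → ∃ T : PointConfig S → PointConfig S, Measurable T ∧
      ∀ᵐ N ∂P₀, distToSet N A < ∞ → 1 ≤ (T N).1 A ∧ c (T N) N ≤ distToSet N A + ε) :
    worstCaseHitProb c P₀ δ A = rareSetDual P₀ δ A := by
  refine le_antisymm (worstCaseHitProb_le_rareSetDual hA hlow P₀ δ) ?_
  rcases eq_zero_or_pos δ with rfl | hpos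
  · obtain ⟨hcl, hN⟩ := hδ.resolve_left (lt_irrefl 0)
    exact rareSetDual_zero_le_worstCaseHitProb hcl P₀ hc hN
  · exact rareSetDual_le_worstCaseHitProb hA P₀ hpos hc hT

end Duality


theorem mainTheorem5 {d : ℕ} {p : ℝ≥0∞} [Fact (1 ≤ p)]
    (E : Set (PiLp p (fun _ : Fin d => ℝ))) (hE : MeasurableSet E)
    (A : Set E) (hA : MeasurableSet A)
    (P₀ : Measure (PointConfig E)) [IsProbabilityMeasure P₀] (δ : ℝ≥0)
    (hδ : 0 < δ ∨
      (IsClosed A ∧ ∀ᵐ N ∂P₀, ∃ r : ℝ, 0 < r ∧ N.1 (Metric.thickening r A) < ∞)) :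
    ((∀ᵐ N ∂P₀, N.1 Set.univ < ∞) →
      worstCaseHitProb finiteCost P₀ δ A = rareSetDual P₀ δ A) ∧
    worstCaseHitProb matchingCost P₀ δ A = rareSetDual P₀ δ A := by
  have hlow : ∀ N N' : PointConfig E, 1 ≤ N.1 A → distToSet N' A ≤ matchingCost N N' :=
    fun N N' h => distToSet_le_matchingCost hA N' h
  refine ⟨fun hfin => ?_, ?_⟩
  · refine worstCaseHitProb_eq_rareSetDual hA P₀ δ hδ
      (fun N N' h => (hlow N N' h).trans (matchingCost_le_finiteCost N N')) ?_ fun ε hε => ?_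
    · filter_upwards [hfin] with N hN
      exact finiteCost_self hN
    · obtain ⟨T, hT, hTN⟩ := exists_measurable_transport hA hε
      refine ⟨T, hT, ?_⟩
      filter_upwards [hfin] with N hN hD
      exact ⟨(hTN N hD).1, (hTN N hD).2.2 hN⟩
  · refine worstCaseHitProb_eq_rareSetDual hA P₀ δ hδ hlow (ae_of_all _ matchingCost_self)
      fun ε hε => ?_
    obtain ⟨T, hT, hTN⟩ := exists_measurable_transport hA hε
    exact ⟨T, hT, ae_of_all _ fun N hD => ⟨(hTN N hD).1, (hTN N hD).2.1⟩⟩
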